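/- Let $\mathbb{F}_q$ be a finite field with $q$ elements. For a linear code $\mathcal{C}\subseteq\mathbb{F}_q^n$ and a positive integer $w$, let $\mathcal{H}_w(\mathcal{C})$ be the multiset of subsets of $\{1,\dots,n\}$ obtained from the multiset of supports $\operatorname{supp}(\mathbf{c})=\{i: c_i\neq 0\}$ of all codewords $\mathbf{c}\in\mathcal{C}$ of Hamming weight $w$ by dividing every multiplicity by $q-1$ (the division is always exact). For integers $1\le t\le w\le n$, a multiset $\mathcal{B}$ of $w$-subsets of $\{1,\dots,n\}$ is a $t$-$(n,w,\lambda)$ design if every $t$-subset of $\{1,\dots,n\}$ is contained in exactly $\lambda$ members of $\mathcal{B}$, counted with multiplicity; here $\lambda\ge 0$ is an integer, and $\lambda=0$ and the empty multiset are allowed. The code $\mathcal{C}$ is almost MDS if it has parameters $[n,k,n-k]$ for some $k$, that is, dimension $k$ and minimum distance $n-k$. It is near MDS (NMDS) if both $\mathcal{C}$ and its dual $\mathcal{C}^\perp$ with respect to the standard bilinear form are almost MDS. Let $\mathcal{C}$ be an NMDS code over $\mathbb{F}_q$ with parameters $[n,k,n-k]$, where $\min\{k,n-k\}\ge 3$.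 Suppose that the minimum-weight codewords of $\mathcal{C}$ support a $2$-design, that is, $\mathcal{H}_{n-k}(\mathcal{C})$ is a $2$-$(n,n-k,\lambda)$ design for some $\lambda$. Then for every integer $w$ with $2\le w\le n$, there are integers $\lambda_w,\lambda_w^\perp\ge 0$ such that $\mathcal{H}_w(\mathcal{C})$ is a $2$-$(n,w,\lambda_w)$ design and $\mathcal{H}_w(\mathcal{C}^\perp)$ is a $2$-$(n,w,\lambda_w^\perp)$ design. -/

import Mathlib

/-- A `t`-`(n, k, lam)` design whose points are the elements of the finite type `P`. The blocks form
a multiset, so repeated blocks are counted with multiplicity. -/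
structure IsTDesign {P : Type*} [Fintype P] [DecidableEq P] (t n k lam : ℕ)
    (blocks : Multiset (Finset P)) : Prop where
  one_le_t : 1 ≤ t
  t_le_k : t ≤ k
  k_le_n : k ≤ n
  card_points : Fintype.card P = n
  card_block : ∀ B ∈ blocks, B.card = k
  card_blocks_containing : ∀ T : Finset P, T.card = t →
    Multiset.card (blocks.filter (fun B => T ⊆ B)) = lam

/-- The multiset obtained from `S` by dividing the multiplicity of each element by `m`. -/
def Multiset.divMultiplicity {α : Type*} [DecidableEq α] (S : Multiset α) (m : ℕ) : Multiset α :=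
  ∑ a ∈ S.toFinset, Multiset.replicate (S.count a / m) a

theorem Multiset.count_divMultiplicity {α : Type*} [DecidableEq α] (S : Multiset α) (m : ℕ)
    (a : α) : (S.divMultiplicity m).count a = S.count a / m := by
  unfold Multiset.divMultiplicity
  rw [Multiset.count_sum']
  simp only [Multiset.count_replicate]
  rw [Finset.sum_ite_eq']
  split_ifs with h
  · rfl
  · rw [Multiset.mem_toFinset] at h
    rw [Multiset.count_eq_zero_of_notMem h, Nat.zero_div]

namespace LinCode

variable {F : Type*} [Field F] [Fintype F] [DecidableEq F] {n : ℕ}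

/-- The dual code with respect to the Euclidean inner product. -/
def dual (C : Submodule F (Fin n → F)) : Submodule F (Fin n → F) where
  carrier := {u | ∀ c ∈ C, dotProduct u c = 0}
  zero_mem' := fun c _ => zero_dotProduct c
  add_mem' := fun {u v} hu hv c hc => by rw [add_dotProduct, hu c hc, hv c hc, add_zero]
  smul_mem' := fun a u hu c hc => by rw [smul_dotProduct, hu c hc, smul_zero]

/-- The support of a word: the set of coordinates at which it does not vanish. Its cardinality is
`hammingNorm c`, by definition. -/
def supp (c : Fin n → F) : Finset (Fin n) := Finset.univ.filter (fun i => c i ≠ 0)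

/-- `C` is an `[n, k, d]` code: its dimension is `k` and its minimum distance, the least Hamming
weight of a nonzero codeword, is `d`. -/
structure HasParameters (C : Submodule F (Fin n → F)) (k d : ℕ) : Prop where
  finrank_eq : Module.finrank F C = k
  minDist : IsLeast {w : ℕ | ∃ c ∈ C, c ≠ 0 ∧ hammingNorm c = w} d

/-- `C` is almost MDS: an `[n, k, n - k]` code for some `k`. -/
def IsAMDS (C : Submodule F (Fin n → F)) : Prop := ∃ k : ℕ, HasParameters C k (n - k)

/-- `C` is near MDS: both `C` and its dual code are almost MDS. -/
def IsNMDS (C : Submodule F (Fin n → F)) : Prop := IsAMDS C ∧ IsAMDS (dual C)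

open scoped Classical in
/-- The finite set of codewords of Hamming weight `w`. -/
noncomputable def codewordsOfWeight (C : Submodule F (Fin n → F)) (w : ℕ) :
    Finset (Fin n → F) := Finset.univ.filter (fun c => c ∈ C ∧ hammingNorm c = w)

/-- The multiset of the supports of the codewords of weight `w`, with every multiplicity divided by
`q - 1`, where `q` is the number of elements of the field. -/
noncomputable def supportBlocks (C : Submodule F (Fin n → F)) (w : ℕ) :
    Multiset (Finset (Fin n)) :=
  ((codewordsOfWeight C w).val.map supp).divMultiplicity (Fintype.card F - 1)

/-- For `w ≠ 0`, the division of multiplicities in `supportBlocks` is exact. -/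
theorem sub_one_dvd_count (C : Submodule F (Fin n → F)) {w : ℕ} (hw : w ≠ 0)
    (B : Finset (Fin n)) :
    Fintype.card F - 1 ∣ ((codewordsOfWeight C w).val.map supp).count B := by
  classical
  have hc : ((codewordsOfWeight C w).val.map supp).count B =
      ((codewordsOfWeight C w).filter (fun c => B = supp c)).card := by
    rw [Multiset.count_map]; rfl
  rw [hc]
  set S := (codewordsOfWeight C w).filter (fun c => B = supp c) with hS
  have hmem : ∀ c, c ∈ S ↔ (c ∈ C ∧ hammingNorm c = w) ∧ B = supp c := by
    intro c; simp [hS, codewordsOfWeight]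
  have hsm : ∀ (a : F), a ≠ 0 → ∀ c ∈ S, a • c ∈ S := by
    intro a ha c hcS
    rw [hmem] at hcS ⊢
    obtain ⟨⟨h1, h2⟩, h3⟩ := hcS
    have hs : supp (a • c) = supp c := by ext i; simp [supp, ha]
    refine ⟨⟨C.smul_mem a h1, ?_⟩, by rw [hs, h3]⟩
    rw [← h2]
    exact congrArg Finset.card hs
  rcases S.eq_empty_or_nonempty with h0 | ⟨c0, hc0⟩
  · simp [h0]
  obtain ⟨i, hi⟩ : B.Nonempty := by
    obtain ⟨⟨h1, h2⟩, h3⟩ := (hmem c0).1 hc0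
    rw [← Finset.card_pos, h3]
    have : (supp c0).card = w := h2
    omega
  have hmaps : ∀ c ∈ S, c i ∈ (Finset.univ.erase (0 : F)) := by
    intro c hcS
    have h3 := ((hmem c).1 hcS).2
    rw [h3] at hi
    simpa [supp] using hi
  rw [Finset.card_eq_sum_card_fiberwise (f := fun c : Fin n → F => c i)
    (t := Finset.univ.erase (0 : F)) (fun c hcS => hmaps c hcS)]
  have hfib : ∀ a ∈ Finset.univ.erase (0 : F),
      (S.filter (fun c => c i = a)).card = (S.filter (fun c => c i = 1)).card := by
    intro a ha
    have ha' : a ≠ 0 := by simpa using ha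
    refine Finset.card_bij' (fun c _ => a⁻¹ • c) (fun c _ => a • c) ?_ ?_ ?_ ?_
    · intro c hc
      rw [Finset.mem_filter] at hc ⊢
      refine ⟨hsm _ (inv_ne_zero ha') _ hc.1, ?_⟩
      simp [hc.2, ha']
    · intro c hc
      rw [Finset.mem_filter] at hc ⊢
      refine ⟨hsm _ ha' _ hc.1, ?_⟩
      simp [hc.2]
    · intro c _
      exact smul_inv_smul₀ ha' c
    · intro c _
      exact inv_smul_smul₀ ha' c
  rw [Finset.sum_congr rfl hfib, Finset.sum_const, Finset.card_erase_of_mem (Finset.mem_univ _),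
    Finset.card_univ, smul_eq_mul]
  exact Dvd.intro _ rfl

end LinCode

/-! Write `q` for the field size and `f(U) = q ^ dim (C ⊓ wordsIn F U)`, the number of codewords
supported in `U`. For an NMDS code `f(U)` depends only on `|U|`, except when `|U| = n - k`, where
the minimum-weight words supported on `U` are added (`card_pow_finrank_inf_wordsIn`). Call a weight
on subsets `t`-regular if every permutation-invariant kernel pairs with it equally at all
`t`-subsets. Functions of `|U|` are regular, and so are weighted `2`-designs for `t = 2`
(`IsRegularWeight.of_two_design`); hence `f` is `2`-regular. Regularity survives any operation
commuting with permutations. Möbius inversion turns `f` into the support enumeration of `C`;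
complementation and scaling by a function of `|U|` turn `f` into its analogue for the dual, a
set-wise MacWilliams identity. Pairing with the kernel of containment in a `w`-set then gives the
designs. -/

/-- There is a permutation carrying one pair of finsets to another pair with the same pattern of
cardinalities. -/
theorem Finset.exists_perm_map_eq_map_eq {α : Type*} [Fintype α] [DecidableEq α]
    {U U' T T' : Finset α} (hU : U.card = U'.card) (hT : T.card = T'.card)
    (hUT : (U ∩ T).card = (U' ∩ T').card) :
    ∃ σ : Equiv.Perm α, U.map σ.toEmbedding = U' ∧ T.map σ.toEmbedding = T' := by
  -- The three given cardinalities determine the sizes of all four cells of the Venn diagram;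
  -- bijections between matching cells glue to `σ`.
  have key : ∀ p : Bool × Bool,
      Nonempty ({x // (decide (x ∈ U), decide (x ∈ T)) = p} ≃
        {x // (decide (x ∈ U'), decide (x ∈ T')) = p}) := by
    intro p
    rw [← Fintype.card_eq, Fintype.card_subtype, Fintype.card_subtype]
    have e1 := Finset.card_sdiff_add_card_inter U T
    have e1' := Finset.card_sdiff_add_card_inter U' T'
    have e2 := Finset.card_sdiff_add_card_inter T U
    have e2' := Finset.card_sdiff_add_card_inter T' U'
    have e3 := Finset.card_union_add_card_inter U T
    have e3' := Finset.card_union_add_card_inter U' T'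
    have e4 := Finset.card_add_card_compl (U ∪ T)
    have e4' := Finset.card_add_card_compl (U' ∪ T')
    rw [Finset.inter_comm] at e2 e2'
    have h1 : ∀ V S : Finset α, (Finset.univ.filter
        (fun x => (decide (x ∈ V), decide (x ∈ S)) = (true, true))) = V ∩ S := by
      intro V S; ext x; simp
    have h2 : ∀ V S : Finset α, (Finset.univ.filter
        (fun x => (decide (x ∈ V), decide (x ∈ S)) = (true, false))) = V \ S := by
      intro V S; ext x; simp
    have h3 : ∀ V S : Finset α, (Finset.univ.filter
        (fun x => (decide (x ∈ V), decide (x ∈ S)) = (false, true))) = S \ V := by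
      intro V S; ext x; simp [and_comm]
    have h4 : ∀ V S : Finset α, (Finset.univ.filter
        (fun x => (decide (x ∈ V), decide (x ∈ S)) = (false, false))) = (V ∪ S)ᶜ := by
      intro V S; ext x; simp
    rcases p with ⟨_ | _, _ | _⟩
    · rw [h4, h4]; omega
    · rw [h3, h3]; omega
    · rw [h2, h2]; omega
    · rw [h1, h1]; omega
  have e := fun p => Classical.choice (key p)
  let σ : Equiv.Perm α :=
    (Equiv.sigmaFiberEquiv fun x => (decide (x ∈ U), decide (x ∈ T))).symm.trans
      ((Equiv.sigmaCongrRight e).trans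
        (Equiv.sigmaFiberEquiv fun x => (decide (x ∈ U'), decide (x ∈ T'))))
  have hσ : ∀ x, (decide (σ x ∈ U'), decide (σ x ∈ T')) = (decide (x ∈ U), decide (x ∈ T)) :=
    fun x => (e (decide (x ∈ U), decide (x ∈ T)) ⟨x, rfl⟩).2
  refine ⟨σ, ?_, ?_⟩
  · ext y
    have := hσ (σ.symm y)
    simp only [Equiv.apply_symm_apply, Prod.mk.injEq, decide_eq_decide] at this
    rw [Finset.mem_map_equiv, this.1]
  · ext y
    have := hσ (σ.symm y)
    simp only [Equiv.apply_symm_apply, Prod.mk.injEq, decide_eq_decide] at this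
    rw [Finset.mem_map_equiv, this.2]

/-! ### Regular weights on subsets and their closure properties. -/

section Regular

variable {α : Type*} [Fintype α] [DecidableEq α]

/-- A kernel on pairs of finsets that is invariant under all permutations of the points. -/
def IsInvariantKernel (K : Finset α → Finset α → ℚ) : Prop :=
  ∀ (σ : Equiv.Perm α) (U T : Finset α), K (U.map σ.toEmbedding) (T.map σ.toEmbedding) = K U T

/-- A weight function on finsets is `t`-regular if pairing it with an invariant kernel gives the
same value at all `t`-subsets. -/
def IsRegularWeight (t : ℕ) (g : Finset α → ℚ) : Prop :=
  ∀ K : Finset α → Finset α → ℚ, IsInvariantKernel K → ∀ T T' : Finset α,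
    T.card = t → T'.card = t → ∑ U, g U * K U T = ∑ U, g U * K U T'

omit [DecidableEq α] in
theorem Finset.sum_map_perm (σ : Equiv.Perm α) (F : Finset α → ℚ) :
    ∑ U : Finset α, F (U.map σ.toEmbedding) = ∑ U, F U :=
  Equiv.sum_comp (Equiv.finsetCongr σ) F

namespace IsRegularWeight

variable {t : ℕ} {g h : Finset α → ℚ}

theorem of_card (t : ℕ) (φ : ℕ → ℚ) : IsRegularWeight t (fun U : Finset α => φ U.card) := by
  intro K hK T T' hT hT'
  obtain ⟨σ, -, hσ⟩ := Finset.exists_perm_map_eq_map_eq (U := (∅ : Finset α)) (U' := ∅)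
    (T := T) (T' := T') rfl (hT.trans hT'.symm) (by simp)
  beta_reduce
  rw [← Finset.sum_map_perm σ (fun U => φ U.card * K U T')]
  refine Finset.sum_congr rfl fun U _ => ?_
  rw [← hσ, hK, Finset.card_map]

omit [DecidableEq α] in
theorem add (hg : IsRegularWeight t g) (hh : IsRegularWeight t h) :
    IsRegularWeight t (fun U => g U + h U) := by
  intro K hK T T' hT hT'
  simp only [add_mul, Finset.sum_add_distrib, hg K hK T T' hT hT', hh K hK T T' hT hT']

-- The factor `φ U.card` is permutation-invariant, so it can be absorbed into the kernel.
omit [DecidableEq α] in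
theorem card_mul (hg : IsRegularWeight t g) (φ : ℕ → ℚ) :
    IsRegularWeight t (fun U => φ U.card * g U) := by
  intro K hK T T' hT hT'
  have := hg (fun U S => φ U.card * K U S)
    (fun σ U S => by simp only [Finset.card_map, hK σ U S]) T T' hT hT'
  simpa only [mul_left_comm, mul_assoc] using this

theorem comp_compl (hg : IsRegularWeight t g) : IsRegularWeight t (fun U => g Uᶜ) := by
  intro K hK T T' hT hT'
  have hc : ∀ S : Finset α, ∑ U, g Uᶜ * K U S = ∑ U, g U * K Uᶜ S := by
    intro S
    rw [← Equiv.sum_comp (Function.Involutive.toPerm _ (compl_involutive (α := Finset α)))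
      (fun U => g U * K Uᶜ S)]
    simp
  rw [hc, hc]
  refine hg (fun U S => K Uᶜ S) (fun σ U S => ?_) T T' hT hT'
  beta_reduce
  rw [← hK σ Uᶜ S]
  congr 1
  ext x
  simp [Finset.mem_map_equiv]

end IsRegularWeight

theorem Finset.sum_neg_one_pow_card_Icc (V S : Finset α) (hVS : V ⊆ S) :
    ∑ U ∈ Finset.univ.filter (fun U => V ⊆ U ∧ U ⊆ S), (-1 : ℚ) ^ (S \ U).card =
      if V = S then 1 else 0 := by
  have h := Finset.sum_powerset_neg_one_pow_card (x := S \ V)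
  have h' : ∑ m ∈ (S \ V).powerset, (-1 : ℚ) ^ m.card = if S \ V = ∅ then 1 else 0 := by
    exact_mod_cast congrArg (Int.cast (R := ℚ)) h
  have hiff : S \ V = ∅ ↔ V = S := by
    rw [Finset.sdiff_eq_empty_iff_subset]
    exact ⟨fun h => hVS.antisymm h, fun h => h ▸ subset_rfl⟩
  simp only [hiff] at h'
  rw [← h']
  refine Finset.sum_bij' (fun U _ => S \ U) (fun W _ => S \ W) ?_ ?_ ?_ ?_ ?_
  · intro U hU
    simp only [Finset.mem_filter, Finset.mem_univ, true_and] at hU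
    exact Finset.mem_powerset.2 (Finset.sdiff_subset_sdiff subset_rfl hU.1)
  · intro W hW
    rw [Finset.mem_powerset] at hW
    simp only [Finset.mem_filter, Finset.mem_univ, true_and]
    exact ⟨fun x hx => Finset.mem_sdiff.2 ⟨hVS hx, fun hxW => (Finset.mem_sdiff.1 (hW hxW)).2 hx⟩,
      Finset.sdiff_subset⟩
  · intro U hU
    simp only [Finset.mem_filter, Finset.mem_univ, true_and] at hU
    exact Finset.sdiff_sdiff_eq_self hU.2
  · intro W hW
    exact Finset.sdiff_sdiff_eq_self ((Finset.mem_powerset.1 hW).trans Finset.sdiff_subset)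
  · intro U _
    rfl

/-- After exchanging sums, `g V` is multiplied by an alternating sum over the interval from `V` to
`S`, which vanishes unless `V = S`. -/
theorem Finset.moebius_subset (g : Finset α → ℚ) (S : Finset α) :
    ∑ U, (if U ⊆ S then (-1 : ℚ) ^ (S \ U).card else 0) * ∑ V, (if V ⊆ U then g V else 0) =
      g S := by
  simp only [Finset.mul_sum]
  rw [Finset.sum_comm, Finset.sum_eq_single S]
  · rw [Finset.sum_eq_single S]
    · simp
    · intro U _ hU
      by_cases h1 : U ⊆ S
      · rw [if_neg fun h2 => hU (h1.antisymm h2), mul_zero]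
      · rw [if_neg h1, zero_mul]
    · simp
  · intro V _ hV
    have : ∀ U, (if U ⊆ S then (-1 : ℚ) ^ (S \ U).card else 0) * (if V ⊆ U then g V else 0) =
        (if V ⊆ U ∧ U ⊆ S then (-1 : ℚ) ^ (S \ U).card else 0) * g V := by
      intro U
      split_ifs <;> simp_all
    simp only [this]
    rw [← Finset.sum_mul, ← Finset.sum_filter]
    by_cases hVS : V ⊆ S
    · rw [Finset.sum_neg_one_pow_card_Icc V S hVS, if_neg hV, zero_mul]
    · rw [Finset.filter_false_of_mem fun U _ h => hVS (h.1.trans h.2), Finset.sum_empty, zero_mul]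
  · simp

/-- Möbius inversion preserves regularity. -/
theorem IsRegularWeight.of_sum_subset {t : ℕ} {g : Finset α → ℚ}
    (hg : IsRegularWeight t (fun U => ∑ V, if V ⊆ U then g V else 0)) : IsRegularWeight t g := by
  intro K hK T T' hT hT'
  -- The Möbius function is itself an invariant kernel, so inversion moves from the weight to the
  -- kernel.
  let K' : Finset α → Finset α → ℚ := fun U R =>
    ∑ S, (if U ⊆ S then (-1 : ℚ) ^ (S \ U).card else 0) * K S R
  have hK' : IsInvariantKernel K' := by
    intro σ U R
    simp only [K']
    rw [← Finset.sum_map_perm σ (fun S => (if U.map σ.toEmbedding ⊆ S then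
      (-1 : ℚ) ^ (S \ U.map σ.toEmbedding).card else 0) * K S (R.map σ.toEmbedding))]
    refine Finset.sum_congr rfl fun S _ => ?_
    rw [hK, ← Finset.map_sdiff, Finset.card_map]
    simp only [Finset.map_subset_map]
  have hc : ∀ R, ∑ S, g S * K S R = ∑ U, (∑ V, if V ⊆ U then g V else 0) * K' U R := by
    intro R
    simp only [K', Finset.mul_sum]
    rw [Finset.sum_comm]
    refine Finset.sum_congr rfl fun S _ => ?_
    nth_rewrite 1 [← Finset.moebius_subset g S]
    rw [Finset.sum_mul]
    refine Finset.sum_congr rfl fun U _ => ?_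
    ring
  rw [hc, hc]
  exact hg K' hK' T T' hT hT'

/-- In a weighted `2`-design, all points have the same replication number. -/
theorem sum_mem_eq_of_two_design {m : ℕ} {g : Finset α → ℚ} {lam : ℚ}
    (hm : 2 ≤ m) (hsupp : ∀ U, g U ≠ 0 → U.card = m)
    (hlam : ∀ T : Finset α, T.card = 2 → ∑ U, (if T ⊆ U then g U else 0) = lam) (x : α) :
    ∑ U, (if x ∈ U then g U else 0) = ((Fintype.card α - 1 : ℕ) : ℚ) * lam / ((m : ℚ) - 1) := by
  have hm' : (m : ℚ) - 1 ≠ 0 := by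
    have : (2 : ℚ) ≤ m := by exact_mod_cast hm
    linarith
  rw [eq_div_iff hm', Finset.sum_mul]
  -- Weighted double count of pairs `(y, U)` with `y ≠ x` and `x, y ∈ U`.
  have h1 : ∑ y ∈ Finset.univ.erase x, ∑ U, (if ({x, y} : Finset α) ⊆ U then g U else 0) =
      ((Fintype.card α - 1 : ℕ) : ℚ) * lam := by
    rw [Finset.sum_congr rfl fun y hy => hlam {x, y}
      (Finset.card_pair (Finset.ne_of_mem_erase hy).symm), Finset.sum_const,
      Finset.card_erase_of_mem (Finset.mem_univ x), Finset.card_univ, nsmul_eq_mul]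
  rw [← h1, Finset.sum_comm]
  refine Finset.sum_congr rfl fun U _ => ?_
  by_cases hU : g U = 0
  · simp [hU]
  by_cases hx : x ∈ U
  · have : ∀ y, (if ({x, y} : Finset α) ⊆ U then g U else 0) = if y ∈ U then g U else 0 := by
      intro y
      simp [Finset.insert_subset_iff, hx]
    simp only [this, if_pos hx]
    rw [← Finset.sum_filter, Finset.sum_const, nsmul_eq_mul]
    have he : (Finset.univ.erase x).filter (· ∈ U) = U.erase x := by
      ext y; simp
    rw [he, Finset.card_erase_of_mem hx, hsupp U hU, Nat.cast_sub (by omega), mul_comm]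
    simp
  · simp [Finset.insert_subset_iff, hx]

/-- The weight function of a weighted `2`-design is `2`-regular. -/
theorem IsRegularWeight.of_two_design {m : ℕ} {g : Finset α → ℚ} {lam : ℚ}
    (hm : 2 ≤ m) (hsupp : ∀ U, g U ≠ 0 → U.card = m)
    (hlam : ∀ T : Finset α, T.card = 2 → ∑ U, (if T ⊆ U then g U else 0) = lam) :
    IsRegularWeight 2 g := by
  intro K hK
  obtain ⟨κ, hκ⟩ : ∃ κ : ℕ → ℚ, ∀ U T : Finset α, U.card = m → T.card = 2 →
      K U T = κ (U ∩ T).card := by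
    classical
    -- `κ j` is read off a chosen representative pair; the value `0` at unattained intersection
    -- sizes is never used.
    refine ⟨fun j => if h : ∃ p : Finset α × Finset α,
      p.1.card = m ∧ p.2.card = 2 ∧ (p.1 ∩ p.2).card = j then K h.choose.1 h.choose.2 else 0, ?_⟩
    intro U T hU hT
    have h : ∃ p : Finset α × Finset α,
        p.1.card = m ∧ p.2.card = 2 ∧ (p.1 ∩ p.2).card = (U ∩ T).card := ⟨(U, T), hU, hT, rfl⟩
    simp only [dif_pos h]
    obtain ⟨a, b, c⟩ := h.choose_spec
    obtain ⟨σ, h1, h2⟩ := Finset.exists_perm_map_eq_map_eq (hU.trans a.symm) (hT.trans b.symm)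
      c.symm
    rw [← h1, ← h2, hK]
  set r := ((Fintype.card α - 1 : ℕ) : ℚ) * lam / ((m : ℚ) - 1) with hr
  -- Since `j = |U ∩ T| ≤ 2`, `κ j = κ 0 + (κ 1 - κ 0) * j + (κ 2 - 2 * κ 1 + κ 0) * [j = 2]`. The
  -- three terms sum to the total weight, twice the replication number, and `lam`, none depending on
  -- `T`.
  have key : ∀ T : Finset α, T.card = 2 → ∑ U, g U * K U T =
      κ 0 * (∑ U, g U) + (κ 1 - κ 0) * (2 * r) + (κ 2 - 2 * κ 1 + κ 0) * lam := by
    intro T hT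
    have h2 : ∑ U, g U * ((U ∩ T).card : ℚ) = 2 * r := by
      have : ∀ U : Finset α, g U * ((U ∩ T).card : ℚ) = ∑ x ∈ T, if x ∈ U then g U else 0 := by
        intro U
        rw [← Finset.sum_filter, Finset.sum_const, nsmul_eq_mul, mul_comm, Finset.inter_comm,
          Finset.filter_mem_eq_inter]
      simp only [this]
      rw [Finset.sum_comm, Finset.sum_congr rfl fun x _ =>
        sum_mem_eq_of_two_design hm hsupp hlam x, Finset.sum_const, hT, nsmul_eq_mul, hr, Nat.cast_ofNat]
    rw [← h2, ← hlam T hT, Finset.mul_sum, Finset.mul_sum, Finset.mul_sum,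
      ← Finset.sum_add_distrib, ← Finset.sum_add_distrib]
    refine Finset.sum_congr rfl fun U _ => ?_
    by_cases hU : g U = 0
    · simp [hU]
    rw [hκ U T (hsupp U hU) hT]
    have hle : (U ∩ T).card ≤ 2 := hT ▸ Finset.card_le_card Finset.inter_subset_right
    have hsub : T ⊆ U ↔ (U ∩ T).card = 2 := by
      rw [← Finset.inter_eq_right]
      exact ⟨fun h => by rw [h, hT], fun h =>
        Finset.eq_of_subset_of_card_le Finset.inter_subset_right (by omega)⟩
    simp only [hsub]
    generalize (U ∩ T).card = j at *
    interval_cases j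
    · norm_num; ring
    · norm_num; ring
    · norm_num; ring
  intro T T' hT hT'
  rw [key T hT, key T' hT']

end Regular

/-! ### Dimensions of shortened codes and their duals. -/

namespace LinCode

variable {F : Type*} [Field F] {n : ℕ}

/-- The words supported in `S`. -/
def wordsIn (F : Type*) [Field F] {n : ℕ} (S : Finset (Fin n)) : Submodule F (Fin n → F) :=
  ⨅ i ∈ ((Sᶜ : Finset (Fin n)) : Set (Fin n)), LinearMap.ker (LinearMap.proj i)

theorem mem_wordsIn {S : Finset (Fin n)} {v : Fin n → F} :
    v ∈ wordsIn F S ↔ ∀ i, i ∉ S → v i = 0 := by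
  simp [wordsIn, Submodule.mem_iInf]

theorem finrank_wordsIn (S : Finset (Fin n)) : Module.finrank F (wordsIn F S) = S.card := by
  classical
  have e := LinearMap.iInfKerProjEquiv F (fun _ : Fin n => F)
    (I := (S : Set (Fin n))) (J := ((Sᶜ : Finset (Fin n)) : Set (Fin n)))
    (by rw [Finset.coe_compl]; exact disjoint_compl_right)
    (by rw [Finset.coe_compl, Set.union_compl_self])
  have h := e.finrank_eq
  rw [Module.finrank_fintype_fun_eq_card] at h
  rw [wordsIn, h]
  simp

theorem dual_eq_orthogonal (C : Submodule F (Fin n → F)) :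
    dual C = LinearMap.BilinForm.orthogonal (dotProductBilin F F) C := by
  ext u
  rw [LinearMap.BilinForm.mem_orthogonal_iff]
  refine forall₂_congr fun c _ => ?_
  rw [dotProduct_comm]
  rfl

theorem finrank_add_finrank_dual (C : Submodule F (Fin n → F)) :
    Module.finrank F C + Module.finrank F (dual C) = n := by
  have hker : LinearMap.ker (dotProductBilin F F : (Fin n → F) →ₗ[F] (Fin n → F) →ₗ[F] F) = ⊥ := by
    rw [LinearMap.ker_eq_bot']
    intro v hv
    exact dotProduct_eq_zero v fun w => LinearMap.congr_fun hv w
  rw [dual_eq_orthogonal, LinearMap.BilinForm.finrank_add_finrank_orthogonal', hker, inf_bot_eq,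
    finrank_bot, add_zero, Module.finrank_fintype_fun_eq_card, Fintype.card_fin]

theorem dual_sup_wordsIn_compl (C : Submodule F (Fin n → F)) (S : Finset (Fin n)) :
    dual (C ⊔ wordsIn F Sᶜ) = dual C ⊓ wordsIn F S := by
  ext u
  rw [Submodule.mem_inf, mem_wordsIn]
  constructor
  · intro hu
    refine ⟨fun c hc => hu c (Submodule.mem_sup_left hc), fun i hi => ?_⟩
    have h := hu (Pi.single i 1) (Submodule.mem_sup_right (mem_wordsIn.2 fun j hj => by
      rw [Pi.single_eq_of_ne]
      rintro rfl
      exact hj (Finset.mem_compl.2 hi)))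
    rwa [dotProduct_single, mul_one] at h
  · rintro ⟨hu, hS⟩ c hc
    obtain ⟨a, ha, b, hb, rfl⟩ := Submodule.mem_sup.1 hc
    rw [dotProduct_add, hu a ha, zero_add]
    refine Finset.sum_eq_zero fun i _ => ?_
    by_cases hi : i ∈ S
    · rw [mem_wordsIn.1 hb i (by simpa using hi), mul_zero]
    · rw [hS i hi, zero_mul]

/-- The dimension of a shortened dual code. -/
theorem finrank_dual_inf_wordsIn (C : Submodule F (Fin n → F)) (S : Finset (Fin n)) :
    Module.finrank F (dual C ⊓ wordsIn F S : Submodule F (Fin n → F)) + Module.finrank F C =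
      S.card + Module.finrank F (C ⊓ wordsIn F Sᶜ : Submodule F (Fin n → F)) := by
  have h1 := finrank_add_finrank_dual (C ⊔ wordsIn F Sᶜ)
  rw [dual_sup_wordsIn_compl] at h1
  have h2 := Submodule.finrank_sup_add_finrank_inf_eq C (wordsIn F Sᶜ)
  rw [finrank_wordsIn] at h2
  have h3 := Finset.card_add_card_compl S
  rw [Fintype.card_fin] at h3
  omega

theorem inf_wordsIn_eq_bot [DecidableEq F] {C : Submodule F (Fin n → F)} {k d : ℕ}
    (hC : HasParameters C k d) {S : Finset (Fin n)} (hS : S.card < d) : C ⊓ wordsIn F S = ⊥ := by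
  rw [Submodule.eq_bot_iff]
  rintro c ⟨hc, hcS⟩
  by_contra h0
  have h1 := hC.minDist.2 ⟨c, hc, h0, rfl⟩
  have h2 : supp c ⊆ S := by
    intro i hi
    by_contra his
    simp [supp, mem_wordsIn.1 hcS i his] at hi
  have h3 : hammingNorm c ≤ S.card := Finset.card_le_card h2
  omega

/-! ### Counting codewords by support. -/

section Counting

variable [Fintype F] [DecidableEq F]

open scoped Classical in
/-- The number of codewords with support `S`. -/
noncomputable def suppCount (C : Submodule F (Fin n → F)) (S : Finset (Fin n)) : ℕ :=
  (Finset.univ.filter fun c => c ∈ C ∧ supp c = S).card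

theorem sum_suppCount_subset (C : Submodule F (Fin n → F)) (U : Finset (Fin n)) :
    ∑ V, (if V ⊆ U then (suppCount C V : ℚ) else 0) =
      (Fintype.card F : ℚ) ^
        Module.finrank F (C ⊓ wordsIn F U : Submodule F (Fin n → F)) := by
  classical
  have h1 : Fintype.card (C ⊓ wordsIn F U : Submodule F (Fin n → F)) =
      (Finset.univ.filter fun c => c ∈ C ∧ supp c ⊆ U).card := by
    rw [← Fintype.card_subtype]
    refine Fintype.card_congr (Equiv.subtypeEquivRight fun c => ?_)
    rw [Submodule.mem_inf, mem_wordsIn]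
    refine and_congr_right fun _ => ⟨fun h i hi => ?_, fun h i hi => ?_⟩
    · by_contra hU
      simp [supp, h i hU] at hi
    · by_contra hU
      exact hi (h (by simpa [supp] using hU))
  rw [← Nat.cast_pow, ← Module.card_eq_pow_finrank, h1,
    Finset.card_eq_sum_card_fiberwise (f := supp) (t := Finset.univ.filter (· ⊆ U))
      (fun c hc => by simpa using (by simpa using hc : c ∈ C ∧ supp c ⊆ U).2),
    Finset.sum_filter, Nat.cast_sum]
  refine Finset.sum_congr rfl fun V _ => ?_
  split_ifs with hV
  · rw [suppCount, Finset.filter_filter]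
    congr 2
    ext c
    simp only [Finset.mem_filter, Finset.mem_univ, true_and]
    constructor
    · rintro ⟨h, rfl⟩; exact ⟨⟨h, hV⟩, rfl⟩
    · rintro ⟨⟨h, -⟩, rfl⟩; exact ⟨h, rfl⟩
  · rfl

theorem suppCount_empty (C : Submodule F (Fin n → F)) : suppCount C ∅ = 1 := by
  classical
  rw [suppCount, Finset.card_eq_one]
  refine ⟨0, ?_⟩
  ext c
  simp only [Finset.mem_filter, Finset.mem_univ, true_and, Finset.mem_singleton]
  constructor
  · rintro ⟨-, h⟩
    ext i
    by_contra hi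
    have : i ∈ supp c := by simpa [supp] using hi
    simp [h] at this
  · rintro rfl
    exact ⟨C.zero_mem, by simp [supp]⟩

theorem suppCount_eq_zero {C : Submodule F (Fin n → F)} {k d : ℕ} (hC : HasParameters C k d)
    {S : Finset (Fin n)} (hS : S.card < d) (h0 : S.Nonempty) : suppCount C S = 0 := by
  classical
  rw [suppCount, Finset.card_eq_zero]
  refine Finset.filter_false_of_mem ?_
  rintro c - ⟨hc, rfl⟩
  have h := hC.minDist.2 ⟨c, hc, ?_, rfl⟩
  · exact absurd h (by simpa [hammingNorm, supp] using hS)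
  · rintro rfl
    simp [supp] at h0

theorem count_map_supp (C : Submodule F (Fin n → F)) (w : ℕ) (S : Finset (Fin n)) :
    ((codewordsOfWeight C w).val.map supp).count S = if S.card = w then suppCount C S else 0 := by
  classical
  have hc : ((codewordsOfWeight C w).val.map supp).count S =
      ((codewordsOfWeight C w).filter (fun c => S = supp c)).card := by
    rw [Multiset.count_map]; rfl
  rw [hc, codewordsOfWeight, Finset.filter_filter]
  split_ifs with h
  · rw [suppCount]
    congr 1
    ext c
    simp only [Finset.mem_filter, Finset.mem_univ, true_and]
    constructor
    · rintro ⟨⟨h1, -⟩, h2⟩; exact ⟨h1, h2.symm⟩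
    · rintro ⟨h1, rfl⟩; exact ⟨⟨h1, h⟩, rfl⟩
  · rw [Finset.card_eq_zero]
    refine Finset.filter_false_of_mem ?_
    rintro c - ⟨⟨-, h1⟩, rfl⟩
    exact h h1

theorem card_sub_one_mul_count_supportBlocks (C : Submodule F (Fin n → F)) {w : ℕ} (hw : w ≠ 0)
    (S : Finset (Fin n)) :
    (Fintype.card F - 1) * (supportBlocks C w).count S =
      if S.card = w then suppCount C S else 0 := by
  rw [supportBlocks, Multiset.count_divMultiplicity,
    Nat.mul_div_cancel' (sub_one_dvd_count C hw S), count_map_supp]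

theorem card_sub_one_mul_card_filter_supportBlocks (C : Submodule F (Fin n → F)) {w : ℕ}
    (hw : w ≠ 0) (T : Finset (Fin n)) :
    (Fintype.card F - 1) * Multiset.card ((supportBlocks C w).filter (fun B => T ⊆ B)) =
      ∑ S, if T ⊆ S then (if S.card = w then suppCount C S else 0) else 0 := by
  rw [← Multiset.sum_count_eq_card (s := Finset.univ) (fun a _ => Finset.mem_univ a),
    Finset.mul_sum]
  refine Finset.sum_congr rfl fun S _ => ?_
  rw [Multiset.count_filter]
  split_ifs with h1 h2
  · rw [card_sub_one_mul_count_supportBlocks C hw, if_pos h2]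
  · rw [card_sub_one_mul_count_supportBlocks C hw, if_neg h2]
  · rw [mul_zero]

/-- If the support enumeration of a code is `t`-regular, then all weights support `t`-designs. -/
theorem exists_isTDesign_supportBlocks {C : Submodule F (Fin n → F)} {t : ℕ} (ht : 1 ≤ t)
    (hC : IsRegularWeight t (fun S => (suppCount C S : ℚ))) {w : ℕ} (htw : t ≤ w) (hwn : w ≤ n) :
    ∃ lam : ℕ, IsTDesign t n w lam (supportBlocks C w) := by
  have hw : w ≠ 0 := by omega
  have hq : 0 < Fintype.card F - 1 := Nat.sub_pos_of_lt Fintype.one_lt_card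
  obtain ⟨T₀, -, hT₀⟩ := Finset.exists_subset_card_eq (s := (Finset.univ : Finset (Fin n)))
    (n := t) (by rw [Finset.card_univ, Fintype.card_fin]; omega)
  refine ⟨_, ht, htw, hwn, Fintype.card_fin n, ?_, fun T hT => Nat.eq_of_mul_eq_mul_left hq
    (?_ : _ = _ * Multiset.card ((supportBlocks C w).filter (fun B => T₀ ⊆ B)))⟩
  · intro B hB
    by_contra hcard
    have h := card_sub_one_mul_count_supportBlocks C hw B
    rw [if_neg hcard] at h
    rcases Nat.mul_eq_zero.1 h with h | h
    · omega
    · exact Multiset.count_eq_zero.1 h hB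
  · rw [card_sub_one_mul_card_filter_supportBlocks C hw,
      card_sub_one_mul_card_filter_supportBlocks C hw]
    -- Pairing with this kernel counts the words of weight `w` whose support contains `R`.
    have h := hC (fun U R => if R ⊆ U then (if U.card = w then 1 else 0) else 0)
      (fun σ U R => by simp only [Finset.map_subset_map, Finset.card_map]) T T₀ hT hT₀
    simp only [mul_ite, mul_one, mul_zero] at h
    exact_mod_cast h

end Counting

end LinCode

/-! ### Near MDS codes. -/

namespace LinCode

section NearMDS

variable {F : Type*} [Field F] [Fintype F] [DecidableEq F] {n k : ℕ}

omit [Fintype F] in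
theorem IsNMDS.hasParameters_dual {C : Submodule F (Fin n → F)} (hC : IsNMDS C)
    (hpar : HasParameters C k (n - k)) (hkn : k ≤ n) : HasParameters (dual C) (n - k) k := by
  obtain ⟨l, hl⟩ := hC.2
  have h := finrank_add_finrank_dual C
  rw [hpar.finrank_eq, hl.finrank_eq] at h
  obtain rfl : l = n - k := by omega
  rwa [Nat.sub_sub_self hkn] at hl

/-- The number of codewords of an NMDS code supported inside `S` depends only on the cardinality of
`S`, up to the contribution of the minimum weight codewords. -/
theorem card_pow_finrank_inf_wordsIn {C : Submodule F (Fin n → F)}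
    (hpar : HasParameters C k (n - k)) (hdual : HasParameters (dual C) (n - k) k)
    (hkn : k < n) (S : Finset (Fin n)) :
    (Fintype.card F : ℚ) ^ Module.finrank F (C ⊓ wordsIn F S : Submodule F (Fin n → F)) =
      (if S.card ≤ n - k then 1 else (Fintype.card F : ℚ) ^ (S.card + k - n)) +
        if S.card = n - k then (suppCount C S : ℚ) else 0 := by
  rcases lt_trichotomy S.card (n - k) with h | h | h
  · rw [inf_wordsIn_eq_bot hpar h, if_pos h.le, if_neg h.ne]
    simp
  · rw [if_pos h.le, if_pos h, ← sum_suppCount_subset]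
    have hS : S ≠ ∅ := by
      rintro rfl
      simp at h
      omega
    -- Any other subset of `S` is nonempty and smaller than the minimum distance, so it supports no
    -- codeword.
    rw [← Finset.sum_subset (Finset.subset_univ {∅, S}), Finset.sum_pair hS.symm, if_pos (by simp),
      if_pos subset_rfl, suppCount_empty, Nat.cast_one]
    intro V _ hV
    simp only [Finset.mem_insert, Finset.mem_singleton, not_or] at hV
    split_ifs with hVS
    · rw [suppCount_eq_zero hpar (h ▸ Finset.card_lt_card (hVS.ssubset_of_ne hV.2))
        (Finset.nonempty_iff_ne_empty.2 hV.1), Nat.cast_zero]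
    · rfl
  · rw [if_neg (by omega), if_neg (by omega), add_zero]
    congr 1
    have h1 := Finset.card_add_card_compl S
    rw [Fintype.card_fin] at h1
    -- Here `|Sᶜ| < k`, the minimum distance of the dual, so no nonzero dual word lives on `Sᶜ` and
    -- the dimension formula forces `|S| + k - n`.
    have h2 := finrank_dual_inf_wordsIn C Sᶜ
    rw [inf_wordsIn_eq_bot hdual (by omega), finrank_bot, compl_compl, hpar.finrank_eq] at h2
    omega

theorem isRegularWeight_suppCount_minWeight {C : Submodule F (Fin n → F)} {w lam : ℕ}
    (hdes : IsTDesign 2 n w lam (supportBlocks C w)) :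
    IsRegularWeight 2 (fun S => if S.card = w then (suppCount C S : ℚ) else 0) := by
  -- Blocks count each support with multiplicity divided by `q - 1`, so counting codewords
  -- multiplies `lam` by `q - 1`.
  refine IsRegularWeight.of_two_design (m := w) (lam := ((Fintype.card F - 1) * lam : ℕ))
    hdes.t_le_k (fun U hU => by by_contra h; exact hU (if_neg h)) fun T hT => ?_
  have hw : w ≠ 0 := by have := hdes.t_le_k; omega
  rw [← hdes.card_blocks_containing T hT, card_sub_one_mul_card_filter_supportBlocks C hw]
  push_cast
  rfl

theorem isRegularWeight_card_pow {C : Submodule F (Fin n → F)} {lam : ℕ}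
    (hpar : HasParameters C k (n - k)) (hdual : HasParameters (dual C) (n - k) k)
    (hkn : k < n) (hdes : IsTDesign 2 n (n - k) lam (supportBlocks C (n - k))) :
    IsRegularWeight 2 fun S =>
      (Fintype.card F : ℚ) ^ Module.finrank F (C ⊓ wordsIn F S : Submodule F (Fin n → F)) := by
  simp only [card_pow_finrank_inf_wordsIn hpar hdual hkn]
  exact (IsRegularWeight.of_card 2
    (fun u => if u ≤ n - k then 1 else (Fintype.card F : ℚ) ^ (u + k - n))).add
    (isRegularWeight_suppCount_minWeight hdes)

omit [DecidableEq F] in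
theorem isRegularWeight_card_pow_dual {C : Submodule F (Fin n → F)} {t : ℕ}
    (h : IsRegularWeight t fun S =>
      (Fintype.card F : ℚ) ^ Module.finrank F (C ⊓ wordsIn F S : Submodule F (Fin n → F))) :
    IsRegularWeight t fun S =>
      (Fintype.card F : ℚ) ^ Module.finrank F (dual C ⊓ wordsIn F S : Submodule F (Fin n → F)) := by
  have hq : (Fintype.card F : ℚ) ≠ 0 := Nat.cast_ne_zero.2 Fintype.card_ne_zero
  -- By `finrank_dual_inf_wordsIn`, the dual count on `S` is `q ^ (|S| - dim C)` times the count of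
  -- `C` on `Sᶜ`.
  convert! h.comp_compl.card_mul (fun u => (Fintype.card F : ℚ) ^ u /
    (Fintype.card F : ℚ) ^ Module.finrank F C) using 2 with S
  rw [div_mul_eq_mul_div, eq_div_iff (pow_ne_zero _ hq), ← pow_add, ← pow_add,
    finrank_dual_inf_wordsIn]

end NearMDS

end LinCode

theorem mainTheorem8 {F : Type*} [Field F] [Fintype F] [DecidableEq F] (n k : ℕ)
    (C : Submodule F (Fin n → F)) (hC : LinCode.IsNMDS C)
    (hpar : LinCode.HasParameters C k (n - k)) (hk : 3 ≤ min k (n - k))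
    (hdes : ∃ lam : ℕ, IsTDesign 2 n (n - k) lam (LinCode.supportBlocks C (n - k))) :
    ∀ w : ℕ, 2 ≤ w → w ≤ n →
      (∃ lam : ℕ, IsTDesign 2 n w lam (LinCode.supportBlocks C w)) ∧
      (∃ lam : ℕ, IsTDesign 2 n w lam (LinCode.supportBlocks (LinCode.dual C) w)) := by
  obtain ⟨lam, hdes⟩ := hdes
  have hkn : k < n := by
    have := hk.trans (min_le_right _ _)
    omega
  have hreg := LinCode.isRegularWeight_card_pow hpar (hC.hasParameters_dual hpar hkn.le) hkn hdes
  have hreg' := LinCode.isRegularWeight_card_pow_dual hreg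
  simp only [← LinCode.sum_suppCount_subset] at hreg hreg'
  exact fun w h2w hwn =>
    ⟨LinCode.exists_isTDesign_supportBlocks one_le_two hreg.of_sum_subset h2w hwn,
      LinCode.exists_isTDesign_supportBlocks one_le_two hreg'.of_sum_subset h2w hwn⟩
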